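/- Let $X$ be a nonzero real Banach space with closed unit ball $B_X$. A slice of $B_X$ is a set of the form $\{x\in B_X : x^*(x)>1-\varepsilon\}$ with $x^*\in X^*$, $\|x^*\|=1$ and $\varepsilon>0$. Suppose that $X$ has the strong diameter 2 property, that is, every finite convex combination of slices $$\sum_{i=1}^n\lambda_iS_i=\Big\{\sum_{i=1}^n\lambda_ix_i : x_i\in S_i\Big\},\qquad \lambda_i\ge 0,\ \sum_{i=1}^n\lambda_i=1,\ S_1,\dots,S_n\text{ slices of }B_X,$$ has diameter $2$. Then the bidual $X^{**}$ contains an isometric copy of $L_1[0,1]$; that is, there is a linear isometry from the real Banach space $L_1[0,1]$ (with respect to Lebesgue measure) into $X^{**}$. -/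

import Mathlib

/-!
By Hahn–Banach separation of two distant points of an average of slices, `X*` is octahedral, so it
contains unit vectors `f₀, f₁, …` with `∑ rₖ |aₖ| ≤ ‖∑ aₖ fₖ‖` and `rₖ → 1`. Write `Y = X*` and let
`ℓₖ` be functionals of norm at most one on `L₁` that norm `L₁` along every tail of the sequence.
Integrating the `ℓ₁` estimate pointwise gives `∑ rₖ ‖gₖ‖ ≤ ‖∑ gₖ ⊗ fₖ‖` in the Bochner space
`L₁(Y)`, so `∑ gₖ ⊗ fₖ ↦ ∑ rₖ ℓₖ(gₖ)` extends to a contractive functional `Λ` on `L₁(Y)`. The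
operator `g ↦ Λ(g ⊗ ·)` from `L₁` to `Y*` is then a contraction, and an isometry because its value
at `g` sends `fₖ` to `rₖ ℓₖ(g)`.
-/

open MeasureTheory

/-- `S` is a slice of the closed unit ball `B_X` of the real normed space `X`: there are a
norm-one functional `f` and `ε > 0` with `S = {x ∈ B_X : f x > 1 - ε}`. -/
def IsUnitBallSlice {X : Type*} [NormedAddCommGroup X] [NormedSpace ℝ X] (S : Set X) : Prop :=
  ∃ f : StrongDual ℝ X, ‖f‖ = 1 ∧ ∃ ε : ℝ, 0 < ε ∧
    S = {x : X | x ∈ Metric.closedBall (0 : X) 1 ∧ 1 - ε < f x}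

/-- The combination `∑ i, w i • S i` of sets: all sums `∑ i, w i • x i` with `x i ∈ S i`. -/
def setCombination {X : Type*} [NormedAddCommGroup X] [NormedSpace ℝ X] {n : ℕ}
    (w : Fin n → ℝ) (S : Fin n → Set X) : Set X :=
  {y : X | ∃ x : Fin n → X, (∀ i, x i ∈ S i) ∧ y = ∑ i, w i • x i}

/-- The strong diameter 2 property: every finite convex combination of slices of the closed
unit ball has diameter 2. (All these sets are bounded, so that `Metric.diam` is the
true diameter.) -/
def StrongDiameterTwoProperty (X : Type*) [NormedAddCommGroup X] [NormedSpace ℝ X] : Prop :=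
  ∀ (n : ℕ) (w : Fin n → ℝ) (S : Fin n → Set X),
    (∀ i, 0 ≤ w i) → ∑ i, w i = 1 → (∀ i, IsUnitBallSlice (S i)) →
      Metric.diam (setCombination w S) = 2

open Filter Topology

section Octahedral

/-- Octahedral normed spaces in the sense of Godefroy: every finite-dimensional subspace is almost
`ℓ₁`-orthogonal to some unit vector. -/
def IsOctahedral (Y : Type*) [NormedAddCommGroup Y] [NormedSpace ℝ Y] : Prop :=
  ∀ V : Submodule ℝ Y, FiniteDimensional ℝ V → ∀ ε : ℝ, 0 < ε →
    ∃ y : Y, ‖y‖ = 1 ∧ ∀ v ∈ V, ∀ t : ℝ, (1 - ε) * (‖v‖ + |t|) ≤ ‖v + t • y‖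

variable {Y : Type*} [NormedAddCommGroup Y] [NormedSpace ℝ Y]

lemma mul_add_le_norm_smul_add_smul {x y : Y} (hx : ‖x‖ ≤ 1) (hy : ‖y‖ ≤ 1) {ε : ℝ} (hε : 0 ≤ ε)
    (hxy : 2 - ε ≤ ‖x + y‖) {a b : ℝ} (ha : 0 ≤ a) (hb : 0 ≤ b) :
    (1 - ε) * (a + b) ≤ ‖a • x + b • y‖ := by
  wlog hab : a ≤ b generalizing x y a b
  · rw [add_comm a, add_comm (a • x)]
    exact this hy hx (by rwa [add_comm]) hb ha (le_of_not_ge hab)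
  have hsplit : a • x + b • y = b • (x + y) - (b - a) • x := by module
  calc (1 - ε) * (a + b) ≤ b * (2 - ε) - (b - a) * 1 := by nlinarith
    _ ≤ b * ‖x + y‖ - (b - a) * ‖x‖ := by gcongr
    _ = ‖b • (x + y)‖ - ‖(b - a) • x‖ := by
      rw [norm_smul_of_nonneg hb, norm_smul_of_nonneg (sub_nonneg.2 hab)]
    _ ≤ ‖a • x + b • y‖ := hsplit ▸ norm_sub_norm_le _ _

lemma mul_norm_add_abs_le_norm_add_smul {V : Submodule ℝ Y} {y : Y} (hy : ‖y‖ = 1) {ε : ℝ}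
    (hε : 0 ≤ ε) (h : ∀ x ∈ V, ‖x‖ = 1 → 2 - ε ≤ ‖x + y‖) {v : Y} (hv : v ∈ V) (t : ℝ) :
    (1 - ε) * (‖v‖ + |t|) ≤ ‖v + t • y‖ := by
  wlog ht : 0 ≤ t generalizing v t
  · have hneg := this (neg_mem hv) (-t) (by linarith)
    rwa [norm_neg, abs_neg, neg_smul, ← neg_add, norm_neg] at hneg
  rw [abs_of_nonneg ht]
  rcases eq_or_ne v 0 with rfl | hv0
  · rw [zero_add, norm_smul_of_nonneg ht, hy, norm_zero]
    nlinarith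
  · have hunit : ‖‖v‖⁻¹ • v‖ = 1 := norm_smul_inv_norm hv0
    have hsmul := mul_add_le_norm_smul_add_smul hunit.le hy.le hε (h _ (V.smul_mem _ hv) hunit)
      (norm_nonneg v) ht
    rwa [smul_inv_smul₀ (norm_ne_zero_iff.2 hv0)] at hsmul

lemma isOctahedral_of_forall_finite
    (h : ∀ s : Set Y, s.Finite → s ⊆ Metric.sphere 0 1 → ∀ ε : ℝ, 0 < ε →
      ∃ y : Y, ‖y‖ = 1 ∧ ∀ x ∈ s, 2 - ε < ‖x + y‖) :
    IsOctahedral Y := by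
  intro V _ ε hε
  have : ProperSpace V := FiniteDimensional.proper_real V
  obtain ⟨N, hNsphere, hNfin, hNcover⟩ :=
    (isCompact_sphere (0 : V) 1).finite_cover_balls (half_pos hε)
  obtain ⟨y, hy, hNy⟩ := h (Subtype.val '' N) (hNfin.image _)
    (by rintro _ ⟨v, hv, rfl⟩; simpa using hNsphere hv) (ε / 2) (half_pos hε)
  refine ⟨y, hy, fun v hv t ↦ mul_norm_add_abs_le_norm_add_smul hy hε.le (fun x hx hx1 ↦ ?_) hv t⟩
  obtain ⟨z, hz, hxz⟩ := Set.mem_iUnion₂.1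
    (hNcover (show (⟨x, hx⟩ : V) ∈ Metric.sphere 0 1 by simpa using hx1))
  have hxz : ‖x - z‖ < ε / 2 := by simpa [Subtype.dist_eq, dist_eq_norm] using hxz
  have hzy : ‖z + y‖ - ‖x - z‖ ≤ ‖x + y‖ := by
    have := norm_sub_norm_le (z + y : Y) (z - x)
    rwa [add_sub_sub_cancel, add_comm y, norm_sub_rev] at this
  linarith [hNy z ⟨z, hz, rfl⟩]

end Octahedral

section StrongDiameterTwo

lemma sub_lt_of_sub_mul_lt_sum {ι : Type*} {s : Finset ι} {w u : ι → ℝ} {a δ : ℝ}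
    (hw : ∀ j ∈ s, 0 ≤ w j) (hw1 : ∑ j ∈ s, w j = 1) (hu : ∀ j ∈ s, u j ≤ a) {i : ι}
    (hi : i ∈ s) (hwi : 0 < w i) (h : a - w i * δ < ∑ j ∈ s, w j * u j) : a - δ < u i := by
  have hterm : w i * (a - u i) ≤ ∑ j ∈ s, w j * (a - u j) :=
    Finset.single_le_sum (f := fun j ↦ w j * (a - u j))
      (fun j hj ↦ mul_nonneg (hw j hj) (sub_nonneg.2 (hu j hj))) hi
  have hsum : ∑ j ∈ s, w j * (a - u j) = a - ∑ j ∈ s, w j * u j := by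
    simp only [mul_sub, Finset.sum_sub_distrib, ← Finset.sum_mul, hw1, one_mul]
  have : w i * (a - u i) < w i * δ := by linarith
  linarith [lt_of_mul_lt_mul_left this hwi.le]

lemma exists_lt_dist_of_lt_diam {α : Type*} [PseudoMetricSpace α] {s : Set α} (hs : s.Nonempty)
    {r : ℝ} (hr : r < Metric.diam s) : ∃ x ∈ s, ∃ y ∈ s, r < dist x y := by
  contrapose! hr
  exact Metric.diam_le_of_forall_dist_le_of_nonempty hs hr

variable {X : Type*} [NormedAddCommGroup X] [NormedSpace ℝ X]

lemma apply_le_norm_of_mem_closedBall (f : StrongDual ℝ X) {x : X}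
    (hx : x ∈ Metric.closedBall 0 1) : f x ≤ ‖f‖ :=
  (Real.le_norm_self _).trans (f.unit_le_opNorm x (mem_closedBall_zero_iff.1 hx))

namespace StrongDiameterTwoProperty

variable [Nontrivial X]

lemma exists_forall_lt_norm_add (hX : StrongDiameterTwoProperty X) {n : ℕ} [NeZero n]
    {F : Fin n → StrongDual ℝ X} (hF : ∀ i, ‖F i‖ = 1) {ε : ℝ} (hε : 0 < ε) :
    ∃ g : StrongDual ℝ X, ‖g‖ = 1 ∧ ∀ i, 2 - ε < ‖F i + g‖ := by
  have hn : (0 : ℝ) < n := Nat.cast_pos.2 (NeZero.pos n)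
  let w : Fin n → ℝ := fun _ ↦ (n : ℝ)⁻¹
  let S : Fin n → Set X := fun i ↦ {x | x ∈ Metric.closedBall (0 : X) 1 ∧ 1 - ε / 2 < F i x}
  have hw : ∀ i, 0 < w i := fun _ ↦ inv_pos.2 hn
  have hw1 : ∑ i, w i = 1 := by simp [w, hn.ne']
  have hdiam : Metric.diam (setCombination w S) = 2 :=
    hX n w S (fun i ↦ (hw i).le) hw1 fun i ↦ ⟨F i, hF i, ε / 2, half_pos hε, rfl⟩
  have hne : (setCombination w S).Nonempty := by
    rw [Set.nonempty_iff_ne_empty]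
    intro hempty
    simp [hempty] at hdiam
  obtain ⟨_, ⟨x, hx, rfl⟩, _, ⟨y, hy, rfl⟩, hxy⟩ :=
    exists_lt_dist_of_lt_diam (r := 2 - (n : ℝ)⁻¹ * (ε / 2)) hne
      (hdiam ▸ sub_lt_self _ (by positivity))
  obtain ⟨g, hg, hgz⟩ := exists_dual_vector' ℝ (∑ i, w i • x i - ∑ i, w i • y i)
  have hgx : ∀ i, g (x i) ≤ 1 := fun i ↦ hg ▸ apply_le_norm_of_mem_closedBall g (hx i).1
  have hgy : ∀ i, -g (y i) ≤ 1 := fun i ↦ by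
    simpa [hg] using apply_le_norm_of_mem_closedBall (-g) (hy i).1
  have hsum : ∑ i, w i * (g (x i) - g (y i)) = ‖∑ i, w i • x i - ∑ i, w i • y i‖ := by
    simpa [mul_sub] using hgz
  refine ⟨g, hg, fun i ↦ ?_⟩
  have hgap : 2 - ε / 2 < g (x i) - g (y i) :=
    sub_lt_of_sub_mul_lt_sum (u := fun j ↦ g (x j) - g (y j)) (fun j _ ↦ (hw j).le) hw1
      (fun j _ ↦ by linarith [hgx j, hgy j]) (Finset.mem_univ i) (hw i)
      (by rwa [hsum, ← dist_eq_norm])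
  calc 2 - ε < F i (x i) + g (x i) := by linarith [(hx i).2, hgy i]
    _ ≤ ‖F i + g‖ := apply_le_norm_of_mem_closedBall (F i + g) (hx i).1

lemma isOctahedral_strongDual (hX : StrongDiameterTwoProperty X) :
    IsOctahedral (StrongDual ℝ X) := by
  refine isOctahedral_of_forall_finite fun s hs hs1 ε hε ↦ ?_
  rcases s.eq_empty_or_nonempty with rfl | hne
  · obtain ⟨g, hg⟩ := exists_norm_eq (StrongDual ℝ X) zero_le_one
    exact ⟨g, hg, by simp⟩
  · obtain ⟨n, F, rfl⟩ := hs.fin_embedding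
    have : NeZero n := ⟨by rintro rfl; exact hne.ne_empty (Set.range_eq_empty _)⟩
    simpa using hX.exists_forall_lt_norm_add
      (fun i ↦ mem_sphere_zero_iff_norm.1 (hs1 (Set.mem_range_self i))) hε

end StrongDiameterTwoProperty

end StrongDiameterTwo

section AsymptoticallyIsometric

/-- The sequence `f` spans an asymptotically isometric copy of `ℓ₁` in the sense of Dowling and
Lennard, with lower constants `r k` tending to `1`. The upper `ℓ₁`-estimate is expressed by
`‖f k‖ ≤ 1`. -/
structure IsAsymptoticallyIsometricL1 (𝕜 : Type*) {Y : Type*} [RCLike 𝕜] [NormedAddCommGroup Y]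
    [NormedSpace 𝕜 Y] (r : ℕ → ℝ) (f : ℕ → Y) : Prop where
  pos : ∀ k, 0 < r k
  tendsto : Tendsto r atTop (𝓝 1)
  norm_le_one : ∀ k, ‖f k‖ ≤ 1
  sum_mul_norm_le : ∀ (s : Finset ℕ) (a : ℕ → 𝕜), ∑ k ∈ s, r k * ‖a k‖ ≤ ‖∑ k ∈ s, a k • f k‖

namespace IsOctahedral

variable {Y : Type*} [NormedAddCommGroup Y] [NormedSpace ℝ Y]

lemma exists_seq (hY : IsOctahedral Y) {ε : ℕ → ℝ} (hε : ∀ k, 0 < ε k) :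
    ∃ f : ℕ → Y, (∀ k, ‖f k‖ = 1) ∧ ∀ k, ∀ v ∈ Submodule.span ℝ (f '' Set.Iio k), ∀ t : ℝ,
      (1 - ε k) * (‖v‖ + |t|) ≤ ‖v + t • f k‖ := by
  classical
  choose g hg1 hg using fun (k : ℕ) (s : Finset Y) ↦
    hY (Submodule.span ℝ (s : Set Y)) inferInstance (ε k) (hε k)
  let s : ℕ → Finset Y := fun n ↦ n.rec ∅ fun k s ↦ insert (g k s) s
  have hs : Monotone s := monotone_nat_of_le_succ fun k ↦ Finset.subset_insert _ _
  refine ⟨fun k ↦ g k (s k), fun k ↦ hg1 _ _, fun k v hv ↦ hg k (s k) v ?_⟩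
  refine Submodule.span_mono ?_ hv
  rintro _ ⟨i, hi, rfl⟩
  exact hs (Nat.succ_le_of_lt hi) (Finset.mem_insert_self (g i (s i)) (s i))

lemma exists_isAsymptoticallyIsometricL1 (hY : IsOctahedral Y) :
    ∃ (r : ℕ → ℝ) (f : ℕ → Y), IsAsymptoticallyIsometricL1 ℝ r f := by
  obtain ⟨r, hr, hr01, hlim⟩ := exists_seq_strictMono_tendsto' (zero_lt_one' ℝ)
  have hpos : ∀ k, 0 < r k := fun k ↦ (hr01 k).1
  -- With these constants the losses telescope: the first `n` steps cost the factor `r n` in total.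
  obtain ⟨f, hf1, hf⟩ := hY.exists_seq (ε := fun k ↦ 1 - r k / r (k + 1))
    fun k ↦ sub_pos.2 ((div_lt_one (hpos _)).2 (hr k.lt_succ_self))
  have hsum : ∀ (a : ℕ → ℝ) (s : Finset ℕ) (n : ℕ), (∀ k ∈ s, k < n) →
      ∑ k ∈ s, r k * |a k| ≤ r n * ‖∑ k ∈ s, a k • f k‖ := by
    intro a s
    induction s using Finset.induction_on_max with
    | empty => simp
    | insert m s hm ih =>
      intro n hn
      have hms : m ∉ s := fun h ↦ (hm m h).false
      rw [Finset.sum_insert hms, Finset.sum_insert hms]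
      set v := ∑ k ∈ s, a k • f k
      have hmem : v ∈ Submodule.span ℝ (f '' Set.Iio m) := Submodule.sum_mem _ fun k hk ↦
        Submodule.smul_mem _ _ (Submodule.subset_span ⟨k, hm k hk, rfl⟩)
      have hstep : r m * (‖v‖ + |a m|) ≤ r (m + 1) * ‖v + a m • f m‖ := by
        have := hf m v hmem (a m)
        rwa [sub_sub_cancel, div_mul_eq_mul_div, div_le_iff₀' (hpos _)] at this
      calc r m * |a m| + ∑ k ∈ s, r k * |a k| ≤ r m * (‖v‖ + |a m|) := by linarith [ih m hm]
        _ ≤ r (m + 1) * ‖v + a m • f m‖ := hstep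
        _ ≤ r n * ‖a m • f m + v‖ := by
          rw [add_comm v]
          gcongr
          exact hr.monotone (hn m (Finset.mem_insert_self m s))
  refine ⟨r, f, hpos, hlim, fun k ↦ (hf1 k).le, fun s a ↦ ?_⟩
  obtain ⟨n, hn⟩ := s.exists_nat_subset_range
  exact (hsum a s n fun k hk ↦ Finset.mem_range.1 (hn hk)).trans
    (mul_le_of_le_one_left (norm_nonneg _) (hr01 n).2.le)

end IsOctahedral

end AsymptoticallyIsometric

section HahnBanach

variable {𝕜 : Type*} [RCLike 𝕜]

lemma exists_strongDual_comp_eq {P Z : Type*} [AddCommGroup P] [Module 𝕜 P]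
    [NormedAddCommGroup Z] [NormedSpace 𝕜 Z] (A : P →ₗ[𝕜] Z) (φ : P →ₗ[𝕜] 𝕜) {C : ℝ} (hC : 0 ≤ C)
    (h : ∀ p, ‖φ p‖ ≤ C * ‖A p‖) : ∃ ψ : StrongDual 𝕜 Z, ‖ψ‖ ≤ C ∧ ∀ p, ψ (A p) = φ p := by
  obtain ⟨θ, rfl⟩ : φ ∈ LinearMap.range A.dualMap := by
    rw [LinearMap.range_dualMap_eq_dualAnnihilator_ker, Submodule.mem_dualAnnihilator]
    intro p hp
    simpa [LinearMap.mem_ker.1 hp] using h p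
  have hθ : ∀ z : LinearMap.range A, ‖θ.domRestrict (LinearMap.range A) z‖ ≤ C * ‖z‖ := by
    rintro ⟨_, p, rfl⟩
    exact h p
  obtain ⟨ψ, hψ, hnorm⟩ := exists_extension_norm_eq _ ((θ.domRestrict _).mkContinuous C hθ)
  exact ⟨ψ, hnorm.trans_le (LinearMap.mkContinuous_norm_le _ hC _),
    fun p ↦ hψ ⟨A p, LinearMap.mem_range_self A p⟩⟩

lemma exists_seq_strongDual_frequently_lt_norm (𝕜 E : Type*) [RCLike 𝕜] [NormedAddCommGroup E]
    [NormedSpace 𝕜 E] [TopologicalSpace.SeparableSpace E] :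
    ∃ ℓ : ℕ → StrongDual 𝕜 E, (∀ k, ‖ℓ k‖ ≤ 1) ∧
      ∀ (x : E) (c : ℝ), c < ‖x‖ → ∃ᶠ k in atTop, c < ‖ℓ k x‖ := by
  let d : ℕ → E := TopologicalSpace.denseSeq E
  choose e he1 he using fun j ↦ exists_dual_vector'' 𝕜 (d j)
  -- Unpairing repeats each functional infinitely often.
  refine ⟨fun k ↦ e k.unpair.1, fun k ↦ he1 _, fun x c hc ↦ frequently_atTop.2 fun n ↦ ?_⟩
  obtain ⟨j, hj⟩ := (TopologicalSpace.denseRange_denseSeq E).exists_dist_lt x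
    (half_pos (sub_pos.2 hc))
  refine ⟨Nat.pair j n, Nat.right_le_pair j n, ?_⟩
  rw [dist_eq_norm] at hj
  have hdj : ‖e j (d j)‖ = ‖d j‖ := by simp [he]
  have hej : ‖e j (d j) - e j x‖ ≤ ‖x - d j‖ := by
    rw [← map_sub, norm_sub_rev x]
    simpa using (e j).le_of_opNorm_le (he1 j) (d j - x)
  simp only [Nat.unpair_pair]
  linarith [norm_sub_norm_le x (d j), norm_sub_norm_le (e j (d j)) (e j x)]

end HahnBanach

section Embedding

variable {Ω 𝕜 Y : Type*} [MeasurableSpace Ω] {μ : Measure Ω} [RCLike 𝕜] [NormedAddCommGroup Y]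
  [NormedSpace 𝕜 Y]

variable (𝕜 Y μ) in
/-- The elementary tensors `g ⊗ y` in the Bochner space `L₁(μ; Y)`, as a bilinear map. -/
noncomputable def l1Tensor : Lp 𝕜 1 μ →L[𝕜] Y →L[𝕜] Lp Y 1 μ :=
  (ContinuousLinearMap.compLpL₂ 1 μ (ContinuousLinearMap.lsmul 𝕜 𝕜).flip).flip

lemma coeFn_l1Tensor (g : Lp 𝕜 1 μ) (y : Y) : l1Tensor 𝕜 Y μ g y =ᵐ[μ] fun t ↦ g t • y :=
  ContinuousLinearMap.coeFn_compLp _ g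

lemma norm_l1Tensor_le : ‖l1Tensor 𝕜 Y μ‖ ≤ 1 := by
  rw [l1Tensor, ContinuousLinearMap.opNorm_flip]
  refine (ContinuousLinearMap.norm_compLpL₂_le _).trans ?_
  rw [ContinuousLinearMap.opNorm_flip]
  exact ContinuousLinearMap.opNorm_lsmul_le

lemma sum_mul_norm_le_norm_sum_l1Tensor {ι : Type*} {r : ι → ℝ} {f : ι → Y} {s : Finset ι}
    (h : ∀ a : ι → 𝕜, ∑ i ∈ s, r i * ‖a i‖ ≤ ‖∑ i ∈ s, a i • f i‖) (G : ι → Lp 𝕜 1 μ) :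
    ∑ i ∈ s, r i * ‖G i‖ ≤ ‖∑ i ∈ s, l1Tensor 𝕜 Y μ (G i) (f i)‖ := by
  have hint : ∀ i, Integrable (fun t ↦ r i * ‖G i t‖) μ := fun i ↦
    (L1.integrable_coeFn (G i)).norm.const_mul _
  have hsum : (∑ i ∈ s, l1Tensor 𝕜 Y μ (G i) (f i) : Lp Y 1 μ) =ᵐ[μ]
      fun t ↦ ∑ i ∈ s, G i t • f i := by
    filter_upwards [Lp.coeFn_fun_finsetSum s fun i ↦ l1Tensor 𝕜 Y μ (G i) (f i),
      s.eventually_all.2 fun i _ ↦ coeFn_l1Tensor (G i) (f i)] with t hts ht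
    rw [hts]
    exact Finset.sum_congr rfl ht
  calc ∑ i ∈ s, r i * ‖G i‖ = ∫ t, ∑ i ∈ s, r i * ‖G i t‖ ∂μ := by
        rw [integral_finsetSum _ fun i _ ↦ hint i]
        simp only [integral_const_mul, L1.norm_eq_integral_norm]
    _ ≤ ∫ t, ‖(∑ i ∈ s, l1Tensor 𝕜 Y μ (G i) (f i) : Lp Y 1 μ) t‖ ∂μ := by
        refine integral_mono_ae (integrable_finsetSum _ fun i _ ↦ hint i)
          (L1.integrable_coeFn _).norm ?_
        filter_upwards [hsum] with t ht
        rw [ht]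
        exact h fun i ↦ G i t
    _ = ‖∑ i ∈ s, l1Tensor 𝕜 Y μ (G i) (f i)‖ := (L1.norm_eq_integral_norm _).symm

lemma exists_clm_strongDual_apply_eq {ι : Type*} {r : ι → ℝ} {f : ι → Y}
    (h : ∀ (s : Finset ι) (a : ι → 𝕜), ∑ i ∈ s, r i * ‖a i‖ ≤ ‖∑ i ∈ s, a i • f i‖)
    {c : ι → StrongDual 𝕜 (Lp 𝕜 1 μ)} (hc : ∀ i, ‖c i‖ ≤ r i) :
    ∃ Φ : Lp 𝕜 1 μ →L[𝕜] StrongDual 𝕜 Y, ‖Φ‖ ≤ 1 ∧ ∀ g i, Φ g (f i) = c i g := by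
  let A : (ι →₀ Lp 𝕜 1 μ) →ₗ[𝕜] Lp Y 1 μ :=
    Finsupp.lsum 𝕜 fun i ↦ ((l1Tensor 𝕜 Y μ).flip (f i)).toLinearMap
  let φ : (ι →₀ Lp 𝕜 1 μ) →ₗ[𝕜] 𝕜 := Finsupp.lsum 𝕜 fun i ↦ (c i).toLinearMap
  have hφ : ∀ G, ‖φ G‖ ≤ 1 * ‖A G‖ := fun G ↦
    calc ‖φ G‖ ≤ ∑ i ∈ G.support, r i * ‖G i‖ :=
          norm_sum_le_of_le _ fun i _ ↦ (c i).le_of_opNorm_le (hc i) (G i)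
      _ ≤ ‖A G‖ := sum_mul_norm_le_norm_sum_l1Tensor (h G.support) G
      _ = 1 * ‖A G‖ := (one_mul _).symm
  obtain ⟨Λ, hΛ, hΛA⟩ := exists_strongDual_comp_eq A φ zero_le_one hφ
  refine ⟨(ContinuousLinearMap.compL 𝕜 Y (Lp Y 1 μ) 𝕜 Λ).comp (l1Tensor 𝕜 Y μ), ?_, fun g i ↦ ?_⟩
  · refine ContinuousLinearMap.opNorm_le_bound _ zero_le_one fun g ↦ ?_
    calc ‖Λ.comp (l1Tensor 𝕜 Y μ g)‖ ≤ ‖Λ‖ * ‖l1Tensor 𝕜 Y μ g‖ := Λ.opNorm_comp_le _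
      _ ≤ 1 * (1 * ‖g‖) := by
        gcongr
        exact (l1Tensor 𝕜 Y μ).le_of_opNorm_le norm_l1Tensor_le g
      _ = 1 * ‖g‖ := by rw [one_mul]
  · simpa [A, φ] using hΛA (Finsupp.single i g)

lemma IsAsymptoticallyIsometricL1.nonempty_linearIsometry {r : ℕ → ℝ} {f : ℕ → Y}
    (hf : IsAsymptoticallyIsometricL1 𝕜 r f) [TopologicalSpace.SeparableSpace (Lp 𝕜 1 μ)] :
    Nonempty (Lp 𝕜 1 μ →ₗᵢ[𝕜] StrongDual 𝕜 Y) := by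
  obtain ⟨ℓ, hℓ1, hℓ⟩ := exists_seq_strongDual_frequently_lt_norm 𝕜 (Lp 𝕜 1 μ)
  obtain ⟨Φ, hΦ1, hΦ⟩ := exists_clm_strongDual_apply_eq hf.sum_mul_norm_le
    (c := fun k ↦ (r k : 𝕜) • ℓ k) fun k ↦ by
      rw [norm_smul, RCLike.norm_of_nonneg (hf.pos k).le]
      exact mul_le_of_le_one_right (hf.pos k).le (hℓ1 k)
  have hlower : ∀ g k, r k * ‖ℓ k g‖ ≤ ‖Φ g‖ := fun g k ↦
    calc r k * ‖ℓ k g‖ = ‖Φ g (f k)‖ := by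
          rw [hΦ, smul_apply, norm_smul, RCLike.norm_of_nonneg (hf.pos k).le]
      _ ≤ ‖Φ g‖ := (Φ g).unit_le_opNorm _ (hf.norm_le_one k)
  refine ⟨⟨Φ.toLinearMap, fun g ↦ le_antisymm ?_ (le_of_forall_lt_imp_le_of_dense fun c hc ↦ ?_)⟩⟩
  · simpa using Φ.le_of_opNorm_le hΦ1 g
  · refine le_of_tendsto_of_frequently (by simpa using hf.tendsto.mul_const c)
      ((hℓ g c hc).mono fun k hk ↦ ?_)
    exact (mul_le_mul_of_nonneg_left hk.le (hf.pos k).le).trans (hlower g k)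

end Embedding

theorem theorem2p4_general {X : Type*} [NormedAddCommGroup X] [NormedSpace ℝ X] [Nontrivial X]
    (hX : StrongDiameterTwoProperty X) {Ω : Type*} [MeasurableSpace Ω] (μ : Measure Ω)
    [TopologicalSpace.SeparableSpace (Lp ℝ 1 μ)] :
    Nonempty (Lp ℝ 1 μ →ₗᵢ[ℝ] StrongDual ℝ (StrongDual ℝ X)) := by
  obtain ⟨_, _, hf⟩ := hX.isOctahedral_strongDual.exists_isAsymptoticallyIsometricL1
  exact hf.nonempty_linearIsometry

theorem theorem2p4 (X : Type*) [NormedAddCommGroup X] [NormedSpace ℝ X] [CompleteSpace X]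
    [Nontrivial X] (hX : StrongDiameterTwoProperty X) :
    Nonempty
      (Lp ℝ 1 (volume.restrict (Set.Icc (0 : ℝ) 1)) →ₗᵢ[ℝ] StrongDual ℝ (StrongDual ℝ X)) := by
  have : Fact ((1 : ENNReal) ≠ ⊤) := ⟨ENNReal.one_ne_top⟩
  exact theorem2p4_general hX _
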